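/- Let $k$ be a field and let $A$ be a finite dimensional associative unital $k$-algebra. Let $\operatorname{mod} A$ be the category of finitely generated left $A$-modules. A module $X\in\operatorname{mod}A$ is a \emph{brick} if $\operatorname{End}_A(X)$ is a division ring, and $A$ is \emph{brick-finite} if it has only finitely many bricks up to isomorphism. A \emph{brick-cycle} is a sequence $X_0\xrightarrow{f_1}X_1\to\cdots\xrightarrow{f_m}X_m$ with $m\ge 1$ in which all $X_i$ are bricks, $X_0\simeq X_m$, and every $f_j$ is non-zero and non-invertible; $A$ is \emph{brick-directed} if there is no brick-cycle in $\operatorname{mod}A$. A \emph{torsion pair} in $\operatorname{mod}A$ is a pair $(\mathcal T,\mathcal F)$ of full, isomorphism-closed subcategories which have only $0$ in common, such that $\mathcal T$ is closed under factor modules, $\mathcal F$ is closed under submodules, and every $M\in\operatorname{mod}A$ has a unique submodule $t(M)$ with $t(M)\in\mathcal T$ and $M/t(M)\in\mathcal F$. Then $\mathcal T$ is called a \emph{torsion class}; it is \emph{brick-splitting} if every brick lies in $\mathcal T$ or in $\mathcal F$. Let $\operatorname{tors}A$ be the lattice of all torsion classes, ordered by inclusion. An element $x$ of a lattice is \emph{left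 modular} if $(y\vee x)\wedge z=y\vee(x\wedge z)$ for all $y\le z$. A finite lattice is \emph{left modular} if it has a maximal chain consisting of left modular elements; it is \emph{extremal} if it has a maximal chain whose length (number of elements minus one) equals both the number of join-irreducible elements and the number of meet-irreducible elements (the least element is not counted as join-irreducible, nor the greatest one as meet-irreducible); it is \emph{trim} if it is both extremal and left modular. The \emph{spine} of an extremal lattice is the set of all elements that lie on a chain of maximal length. \textbf{Theorem.} Let $A$ be a brick-finite algebra. The following are equivalent: \begin{enumerate} \item $A$ is brick-directed; \item $\operatorname{tors}A$ is (a finite lattice that is) left modular; \item $\operatorname{tors}A$ is (a finite lattice that is) extremal; \item $\operatorname{tors}A$ is a (finite) trim lattice. \end{enumerate} Moreover, if these conditions hold, then the spine of $\operatorname{tors}A$ is exactly the set of all brick-splitting torsion classes, and it is a distributive sublattice of $\operatorname{tors}A$. -/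

import Mathlib

universe v u

/-! ### Lattice-theoretic notions -/

section LatticeNotions

/-- An element `x` of a lattice is left modular if `(y ⊔ x) ⊓ z = y ⊔ (x ⊓ z)` for all `y ≤ z`. -/
def IsLeftModularElement {L : Type*} [Lattice L] (x : L) : Prop :=
  ∀ y z : L, y ≤ z → (y ⊔ x) ⊓ z = y ⊔ (x ⊓ z)

/-- A finite lattice is left modular if it has a maximal chain of left modular elements. -/
def IsLeftModularLattice (L : Type*) [Lattice L] : Prop :=
  Finite L ∧ ∃ C : Set L, IsMaxChain (· ≤ ·) C ∧ ∀ x ∈ C, IsLeftModularElement x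

/-- A finite lattice is extremal if it has a maximal chain whose length (its number of elements
minus one) equals both the number of join-irreducible elements and the number of meet-irreducible
elements.  (`SupIrred` excludes the least element and `InfIrred` the greatest one.) -/
def IsExtremalLattice (L : Type*) [Lattice L] : Prop :=
  Finite L ∧ ∃ C : Set L, IsMaxChain (· ≤ ·) C ∧
    C.encard = {x : L | SupIrred x}.encard + 1 ∧ C.encard = {x : L | InfIrred x}.encard + 1

/-- A finite lattice is trim if it is extremal and left modular. -/
def IsTrimLattice (L : Type*) [Lattice L] : Prop :=
  IsExtremalLattice L ∧ IsLeftModularLattice L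

/-- The set of all elements that lie on a chain of maximal length. -/
def latticeSpine (L : Type*) [Lattice L] : Set L :=
  {x | ∃ C : Set L, IsChain (· ≤ ·) C ∧
    (∀ D : Set L, IsChain (· ≤ ·) D → D.encard ≤ C.encard) ∧ x ∈ C}

/-- A subset of a lattice is a distributive sublattice if it is closed under `⊔` and `⊓`
and the distributive law holds in it. -/
def IsDistributiveSublattice {L : Type*} [Lattice L] (S : Set L) : Prop :=
  IsSublattice S ∧ ∀ x ∈ S, ∀ y ∈ S, ∀ z ∈ S, x ⊓ (y ⊔ z) = (x ⊓ y) ⊔ (x ⊓ z)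

end LatticeNotions

/-! ### Bricks -/

section Bricks

open CategoryTheory

variable {A : Type u} [Ring A]

/-- A brick: a finitely generated module whose endomorphism ring is a division ring. -/
def IsBrick (X : ModuleCat.{u} A) : Prop :=
  Module.Finite A X ∧ Nontrivial (Module.End A X) ∧ ∀ f : Module.End A X, f ≠ 0 → IsUnit f

variable (A) in
/-- The set of isomorphism classes of bricks. -/
def brickClasses : Set (Quotient (isIsomorphicSetoid (ModuleCat.{u} A))) :=
  {c | ∃ X : ModuleCat.{u} A, IsBrick X ∧ Quotient.mk _ X = c}

variable (A) in
/-- There are only finitely many bricks up to isomorphism. -/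
def IsBrickFinite : Prop := (brickClasses A).Finite

/-- A sequence `X 0 ⟶ X 1 ⟶ ⋯ ⟶ X m` with `m ≥ 1` is a brick-cycle if all `X i` are bricks,
`X 0 ≅ X m`, and all maps are nonzero and non-invertible. -/
def IsBrickCycle (m : ℕ) (X : Fin (m + 1) → ModuleCat.{u} A)
    (f : ∀ j : Fin m, X j.castSucc ⟶ X j.succ) : Prop :=
  1 ≤ m ∧ (∀ i, IsBrick (X i)) ∧ Nonempty (X 0 ≅ X (Fin.last m)) ∧
    ∀ j, f j ≠ 0 ∧ ¬ IsIso (f j)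

variable (A) in
/-- There are no brick-cycles. -/
def IsBrickDirected : Prop :=
  ¬ ∃ (m : ℕ) (X : Fin (m + 1) → ModuleCat.{u} A) (f : ∀ j : Fin m, X j.castSucc ⟶ X j.succ),
    IsBrickCycle m X f

end Bricks

/-! ### Torsion pairs and torsion classes -/

section TorsionPairs

open CategoryTheory CategoryTheory.Limits

variable {A : Type u} [Ring A]

/-- Torsion pairs `(T, F)` in the category of finitely generated modules. Full subcategories of
finitely generated modules are given as properties of modules which imply finite generation. -/
structure IsTorsionPair (T F : ObjectProperty (ModuleCat.{u} A)) : Prop where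
  finite_left : ∀ M : ModuleCat.{u} A, T M → Module.Finite A M
  finite_right : ∀ M : ModuleCat.{u} A, F M → Module.Finite A M
  inter : ∀ M : ModuleCat.{u} A, (T M ∧ F M) ↔ IsZero M
  quotients : T.IsClosedUnderQuotients
  subobjects : F.IsClosedUnderSubobjects
  existsUnique_torsion : ∀ M : ModuleCat.{u} A, Module.Finite A M →
    ∃! t : Submodule A M, T (ModuleCat.of A t) ∧ F (ModuleCat.of A (M ⧸ t))

/-- The torsion classes in the category of finitely generated modules over a finite dimensional
`k`-algebra `A`: those `T` which are part of a torsion pair `(T, F)`. -/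
@[ext]
structure Tors (k : Type v) (A : Type u) [Field k] [Ring A] [Algebra k A]
    [Module.Finite k A] where
  carrier : ObjectProperty (ModuleCat.{u} A)
  exists_pair : ∃ F : ObjectProperty (ModuleCat.{u} A), IsTorsionPair carrier F

namespace IsTorsionPair

variable {T F : ObjectProperty (ModuleCat.{u} A)}

lemma of_surjective (hT : T.IsClosedUnderQuotients) {M N : Type u} [AddCommGroup M] [Module A M]
    [AddCommGroup N] [Module A N] (f : M →ₗ[A] N) (hf : Function.Surjective f)
    (hM : T (ModuleCat.of A M)) : T (ModuleCat.of A N) := by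
  have : Epi (ModuleCat.ofHom f) := (ModuleCat.epi_iff_surjective _).2 hf
  exact T.prop_of_epi (ModuleCat.ofHom f) hM

lemma of_injective (hF : F.IsClosedUnderSubobjects) {M N : Type u} [AddCommGroup M] [Module A M]
    [AddCommGroup N] [Module A N] (f : M →ₗ[A] N) (hf : Function.Injective f)
    (hN : F (ModuleCat.of A N)) : F (ModuleCat.of A M) := by
  have : Mono (ModuleCat.ofHom f) := (ModuleCat.mono_iff_injective _).2 hf
  exact F.prop_of_mono (ModuleCat.ofHom f) hN

lemma subsingleton (h : IsTorsionPair T F) {M : Type u} [AddCommGroup M] [Module A M]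
    (hT : T (ModuleCat.of A M)) (hF : F (ModuleCat.of A M)) : Subsingleton M :=
  ModuleCat.isZero_iff_subsingleton.1 ((h.inter _).1 ⟨hT, hF⟩)

lemma hom_eq_zero (h : IsTorsionPair T F) {M N : Type u} [AddCommGroup M] [Module A M]
    [AddCommGroup N] [Module A N] (hM : T (ModuleCat.of A M)) (hN : F (ModuleCat.of A N))
    (f : M →ₗ[A] N) : f = 0 := by
  have h1 : T (ModuleCat.of A (LinearMap.range f)) :=
    of_surjective h.quotients f.rangeRestrict f.surjective_rangeRestrict hM
  have h2 : F (ModuleCat.of A (LinearMap.range f)) :=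
    of_injective h.subobjects (LinearMap.range f).subtype Subtype.val_injective hN
  have := h.subsingleton h1 h2
  exact LinearMap.range_eq_bot.1 ((Submodule.subsingleton_iff_eq_bot).1 this)

/-- Torsion classes are closed under extensions. -/
lemma extension (h : IsTorsionPair T F) {M : Type u} [AddCommGroup M] [Module A M]
    [Module.Finite A M] (N : Submodule A M) (h1 : T (ModuleCat.of A N))
    (h2 : T (ModuleCat.of A (M ⧸ N))) : T (ModuleCat.of A M) := by
  obtain ⟨t, ⟨ht, hF⟩, -⟩ := h.existsUnique_torsion (ModuleCat.of A M) ‹_›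
  change Submodule A M at t
  have hN : N ≤ t := by
    intro x hx
    have := LinearMap.congr_fun (h.hom_eq_zero h1 hF (t.mkQ ∘ₗ N.subtype)) ⟨x, hx⟩
    exact (Submodule.Quotient.mk_eq_zero t).1 this
  have h3 : T (ModuleCat.of A (M ⧸ t)) :=
    of_surjective h.quotients (Submodule.factor hN) (Submodule.factor_surjective hN) h2
  have h4 : Subsingleton (M ⧸ t) := h.subsingleton h3 hF
  have h5 : t = ⊤ := Submodule.Quotient.subsingleton_iff.1 h4
  exact of_surjective h.quotients t.subtype (fun x => ⟨⟨x, h5 ▸ Submodule.mem_top⟩, rfl⟩) ht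

/-- Over a Noetherian ring, a class of finitely generated modules that contains the zero modules
and is closed under quotients and extensions is a torsion class. -/
lemma exists_of_closed [IsNoetherianRing A] (T : ObjectProperty (ModuleCat.{u} A))
    (hfin : ∀ M : ModuleCat.{u} A, T M → Module.Finite A M)
    (hzero : ∀ M : ModuleCat.{u} A, IsZero M → T M)
    (hquot : T.IsClosedUnderQuotients)
    (hext : ∀ (M : Type u) [AddCommGroup M] [Module A M] [Module.Finite A M]
      (N : Submodule A M), T (ModuleCat.of A N) → T (ModuleCat.of A (M ⧸ N)) →
        T (ModuleCat.of A M)) :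
    ∃ F : ObjectProperty (ModuleCat.{u} A), IsTorsionPair T F := by
  let F : ObjectProperty (ModuleCat.{u} A) := fun M =>
    Module.Finite A M ∧ ∀ X : ModuleCat.{u} A, T X → ∀ f : X →ₗ[A] M, f = 0
  have key : ∀ (M : Type u) [AddCommGroup M] [Module A M] (N N' : Submodule A M),
      T (ModuleCat.of A N) → F (ModuleCat.of A (M ⧸ N')) → N ≤ N' := by
    intro M _ _ N N' hN hN' x hx
    have := LinearMap.congr_fun (hN'.2 _ hN (N'.mkQ ∘ₗ N.subtype)) ⟨x, hx⟩
    exact (Submodule.Quotient.mk_eq_zero N').1 this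
  refine ⟨F, hfin, fun M h => h.1, fun M => ⟨?_, ?_⟩, hquot, ⟨?_⟩, ?_⟩
  · rintro ⟨hT, hF⟩
    refine ModuleCat.isZero_iff_subsingleton.2 ⟨fun a b => ?_⟩
    have := hF.2 M hT LinearMap.id
    calc a = LinearMap.id (R := A) a := rfl
      _ = LinearMap.id (R := A) b := by rw [this]; rfl
      _ = b := rfl
  · intro hM
    refine ⟨hzero M hM, hfin M (hzero M hM), fun X _ f => ?_⟩
    have := ModuleCat.isZero_iff_subsingleton.1 hM
    exact LinearMap.ext fun x => Subsingleton.elim _ _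
  · intro X Y f _ hY
    have hf := (ModuleCat.mono_iff_injective f).1 inferInstance
    have := hY.1
    refine ⟨Module.Finite.of_injective f.hom hf, fun Z hZ g => ?_⟩
    have h0 := hY.2 Z hZ (f.hom ∘ₗ g)
    refine LinearMap.ext fun z => hf ?_
    have := LinearMap.congr_fun h0 z
    simpa using this
  · intro M hM
    have hbot : T (ModuleCat.of A (⊥ : Submodule A M)) :=
      hzero _ (ModuleCat.isZero_iff_subsingleton.2
        (inferInstanceAs (Subsingleton (⊥ : Submodule A M))))
    obtain ⟨t, ht, hmax⟩ := set_has_maximal_iff_noetherian.2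
      (inferInstanceAs (IsNoetherian A M))
      {N : Submodule A M | T (ModuleCat.of A N)} ⟨⊥, hbot⟩
    have hF : F (ModuleCat.of A (M ⧸ t)) := by
      refine ⟨inferInstanceAs (Module.Finite A (M ⧸ t)), fun X hX f => ?_⟩
      change X →ₗ[A] (M ⧸ t) at f
      have hR : T (ModuleCat.of A (LinearMap.range f)) :=
        of_surjective hquot f.rangeRestrict f.surjective_rangeRestrict hX
      let N : Submodule A M := (LinearMap.range f).comap t.mkQ
      have htN : t ≤ N := fun x hx => by
        have : t.mkQ x = 0 := (Submodule.Quotient.mk_eq_zero t).2 hx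
        simp [N, this]
      have hNT : T (ModuleCat.of A N) := by
        let K : Submodule A N := t.comap N.subtype
        refine hext N K ?_ ?_
        · exact of_surjective hquot (Submodule.comapSubtypeEquivOfLe htN).symm.toLinearMap
            (Submodule.comapSubtypeEquivOfLe htN).symm.surjective ht
        · let g : N →ₗ[A] LinearMap.range f :=
            (t.mkQ ∘ₗ N.subtype).codRestrict _ (fun x => x.2)
          have hg : Function.Surjective g := by
            rintro ⟨y, hy⟩
            obtain ⟨m, rfl⟩ := t.mkQ_surjective y
            exact ⟨⟨m, hy⟩, rfl⟩
          have hK : K = LinearMap.ker g := by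
            ext x
            rw [LinearMap.mem_ker, ← Subtype.coe_inj]
            exact (Submodule.Quotient.mk_eq_zero t).symm
          rw [hK]
          exact of_surjective hquot (g.quotKerEquivOfSurjective hg).symm.toLinearMap
            (g.quotKerEquivOfSurjective hg).symm.surjective hR
      have hNt : N = t := by
        by_contra hne
        exact hmax N hNT (lt_of_le_of_ne htN (Ne.symm hne))
      refine LinearMap.ext fun x => ?_
      obtain ⟨m, hm⟩ := t.mkQ_surjective (f x)
      have hmN : m ∈ N := ⟨x, hm.symm⟩
      rw [hNt] at hmN
      rw [← hm]
      exact (Submodule.Quotient.mk_eq_zero t).2 hmN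
    exact ⟨t, ⟨ht, hF⟩, fun N hN => le_antisymm (key M N t hN.1 hF) (key M t N ht hN.2)⟩

end IsTorsionPair

namespace Tors

variable {k : Type v} {A : Type u} [Field k] [Ring A] [Algebra k A] [Module.Finite k A]

/-- Torsion classes are ordered by inclusion. -/
instance : PartialOrder (Tors k A) := PartialOrder.lift Tors.carrier fun _ _ h => Tors.ext h

/-- The meet is the intersection (within the finitely generated modules). -/
instance : InfSet (Tors k A) where
  sInf S :=
    { carrier := fun M => Module.Finite A M ∧ ∀ T ∈ S, T.carrier M
      exists_pair := by
        have : IsNoetherianRing A := IsNoetherianRing.of_finite k A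
        refine IsTorsionPair.exists_of_closed _ (fun M h => h.1) ?_ ⟨?_⟩ ?_
        · intro M hM
          have := ModuleCat.isZero_iff_subsingleton.1 hM
          refine ⟨inferInstance, fun T _ => ?_⟩
          obtain ⟨F, hF⟩ := T.exists_pair
          exact ((hF.inter M).2 hM).1
        · intro X Y f _ hX
          have := hX.1
          refine ⟨Module.Finite.of_surjective f.hom
            ((ModuleCat.epi_iff_surjective f).1 inferInstance), fun T hT => ?_⟩
          obtain ⟨F, hF⟩ := T.exists_pair
          have := hF.quotients
          exact T.carrier.prop_of_epi f (hX.2 T hT)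
        · intro M _ _ hM N h1 h2
          refine ⟨hM, fun T hT => ?_⟩
          obtain ⟨F, hF⟩ := T.exists_pair
          exact hF.extension N (h1.2 T hT) (h2.2 T hT) }

/-- The complete lattice of torsion classes, ordered by inclusion. -/
instance : CompleteLattice (Tors k A) :=
  completeLatticeOfInf _ fun S => by
    refine ⟨fun T hT M hM => hM.2 T hT, fun U hU M hM => ⟨?_, fun T hT => hU hT M hM⟩⟩
    obtain ⟨F, hF⟩ := U.exists_pair
    exact hF.finite_left M hM

/-- A torsion class `T` is brick-splitting if it belongs to a torsion pair `(T, F)` such that every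
brick lies in `T` or in `F`. -/
def IsBrickSplitting (T : Tors k A) : Prop :=
  ∃ F : ObjectProperty (ModuleCat.{u} A), IsTorsionPair T.carrier F ∧
    ∀ X : ModuleCat.{u} A, IsBrick X → T.carrier X ∨ F X

end Tors

end TorsionPairs

/-! A brick B gives two torsion classes: `gen k A B`, the least one containing B, and `leftPerp k A
B`, the greatest one for which B is torsion-free. Index these pairs (j b, m b) by the classes b of
bricks. A nonzero map from b to c exists exactly when j b ≰ m c. If T ⊄ U, a shortest nonzero module
that is T-torsion and U-torsion-free is a brick (`Tors.exists_minimal_brick`), so the pairs detect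
every failing inequality (`IsSeparating`). Brick-splitting becomes the condition that j b ≤ x or x ≤
m b for each b (`IsSplitting`).

Let n be the number of brick classes, which is also the number of join-irreducibles and of
meet-irreducibles. Each strict step of a chain enlarges {b | j b ≤ x}, so chains have at most n + 1
elements. Without brick-cycles, the nonzero maps generate a partial order on the classes. The joins
of the initial segments of a linear extension form a chain of n + 1 splitting elements, and
splitting elements are left modular; hence the lattice is trim.

Conversely, the members of a chain of n + 1 elements are splitting by counting, and left modular
elements are splitting by a direct argument with modules. In the extremal and in the left modular
case the chain also separates the brick classes. Counting the members of the chain not above j b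
then gives a height that drops along nonzero maps between non-isomorphic bricks, which excludes
brick-cycles. The spine is the union of the chains with n + 1 elements. -/

/-! ### Bricks and isomorphisms. -/

section BrickModules

open CategoryTheory

variable {A : Type u} [Ring A] {B C : ModuleCat.{u} A}

lemma IsBrick.bijective (hB : IsBrick B) {f : B →ₗ[A] B} (hf : f ≠ 0) : Function.Bijective f :=
  (Module.End.isUnit_iff f).1 (hB.2.2 f hf)

lemma IsBrick.id_ne_zero (hB : IsBrick B) : (LinearMap.id : B →ₗ[A] B) ≠ 0 :=
  have := hB.2.1
  one_ne_zero (α := Module.End A B)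

lemma nonempty_iso_of_bijective (f : B →ₗ[A] C) (hf : Function.Bijective f) : Nonempty (B ≅ C) :=
  ⟨(LinearEquiv.ofBijective f hf).toModuleIso⟩

lemma IsBrick.of_iso (hB : IsBrick B) (e : B ≅ C) : IsBrick C := by
  let l : B ≃ₗ[A] C := e.toLinearEquiv
  obtain ⟨h1, h2, h3⟩ := hB
  refine ⟨Module.Finite.equiv l, l.conjRingEquiv.injective.nontrivial, fun f hf => ?_⟩
  have := h3 (l.conjRingEquiv.symm f) (by simpa using hf)
  exact (isUnit_map_iff l.conjRingEquiv.symm f).1 this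

lemma IsBrick.isIso (hB : IsBrick B) (e : B ≅ C) (f : B ⟶ C) (hf : f ≠ 0) : IsIso f := by
  have h : (f ≫ e.inv).hom ≠ 0 := by
    intro h0
    apply hf
    have h1 : f ≫ e.inv = 0 := ModuleCat.hom_ext h0
    simpa using congrArg (· ≫ e.hom) h1
  have h2 : IsIso (f ≫ e.inv) := (ConcreteCategory.isIso_iff_bijective _).2 (hB.bijective h)
  exact IsIso.of_isIso_comp_right f e.inv

end BrickModules

/-! ### Torsion classes generated by a module or left orthogonal to it. -/

namespace Tors

open CategoryTheory CategoryTheory.Limits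

variable {k : Type v} {A : Type u} [Field k] [Ring A] [Algebra k A] [Module.Finite k A]

section Basic

variable {M N : Type u} [AddCommGroup M] [Module A M] [AddCommGroup N] [Module A N]

lemma module_finite (T : Tors k A) (h : T.carrier (ModuleCat.of A M)) : Module.Finite A M := by
  obtain ⟨F, hF⟩ := T.exists_pair
  exact hF.finite_left _ h

lemma of_surjective (T : Tors k A) (f : M →ₗ[A] N) (hf : Function.Surjective f)
    (h : T.carrier (ModuleCat.of A M)) : T.carrier (ModuleCat.of A N) := by
  obtain ⟨F, hF⟩ := T.exists_pair
  exact IsTorsionPair.of_surjective hF.quotients f hf h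

lemma range_mem (T : Tors k A) (f : M →ₗ[A] N) (h : T.carrier (ModuleCat.of A M)) :
    T.carrier (ModuleCat.of A (LinearMap.range f)) :=
  T.of_surjective f.rangeRestrict f.surjective_rangeRestrict h

variable (k A) in
/-- The torsion class of all finitely generated modules without nonzero maps to `M`. -/
def leftPerp (M : Type u) [AddCommGroup M] [Module A M] : Tors k A where
  carrier := fun X => Module.Finite A X ∧ ∀ f : X →ₗ[A] M, f = 0
  exists_pair := by
    have : IsNoetherianRing A := IsNoetherianRing.of_finite k A
    refine IsTorsionPair.exists_of_closed _ (fun M h => h.1) ?_ ⟨?_⟩ ?_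
    · intro X hX
      have := ModuleCat.isZero_iff_subsingleton.1 hX
      exact ⟨inferInstance, fun f => LinearMap.ext fun x => by
        rw [Subsingleton.elim x 0, map_zero, map_zero]⟩
    · intro X Y f _ hX
      have hf := (ModuleCat.epi_iff_surjective f).1 inferInstance
      have := hX.1
      refine ⟨Module.Finite.of_surjective f.hom hf, fun g => LinearMap.ext fun y => ?_⟩
      obtain ⟨x, rfl⟩ := hf y
      exact LinearMap.congr_fun (hX.2 (g ∘ₗ f.hom)) x
    · intro X _ _ hX N h1 h2
      refine ⟨hX, fun f => ?_⟩
      have hN : N ≤ LinearMap.ker f := fun x hx =>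
        LinearMap.congr_fun (h1.2 (f ∘ₗ N.subtype)) ⟨x, hx⟩
      have h0 := h2.2 (N.liftQ f hN)
      refine LinearMap.ext fun x => ?_
      have := LinearMap.congr_fun h0 (N.mkQ x)
      simpa using this

lemma mem_leftPerp [Module.Finite A M] :
    (leftPerp k A N).carrier (ModuleCat.of A M) ↔ ∀ f : M →ₗ[A] N, f = 0 :=
  ⟨fun h => h.2, fun h => ⟨‹_›, h⟩⟩

lemma leftPerp_le_of_injective (f : M →ₗ[A] N) (hf : Function.Injective f) :
    leftPerp k A N ≤ leftPerp k A M := fun _ hX =>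
  ⟨hX.1, fun g => LinearMap.ext fun x => hf <| by
    simpa using LinearMap.congr_fun (hX.2 (f ∘ₗ g)) x⟩

lemma eq_zero_of_le_leftPerp {T : Tors k A} (h : T ≤ leftPerp k A N)
    (hM : T.carrier (ModuleCat.of A M)) (f : M →ₗ[A] N) : f = 0 :=
  (h _ hM).2 f

lemma subsingleton_of_le_leftPerp {T : Tors k A} (h : T ≤ leftPerp k A M)
    (hM : T.carrier (ModuleCat.of A M)) : Subsingleton M :=
  subsingleton_of_forall_eq 0 fun x =>
    LinearMap.congr_fun (eq_zero_of_le_leftPerp h hM LinearMap.id) x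

variable (k A) in
/-- The smallest torsion class containing `M`. -/
def gen (M : Type u) [AddCommGroup M] [Module A M] : Tors k A :=
  sInf {T | T.carrier (ModuleCat.of A M)}

lemma gen_le_iff [Module.Finite A M] {T : Tors k A} :
    gen k A M ≤ T ↔ T.carrier (ModuleCat.of A M) :=
  ⟨fun h => h _ ⟨‹_›, fun _ hT => hT⟩, fun h => sInf_le h⟩

lemma mem_gen [Module.Finite A M] : (gen k A M).carrier (ModuleCat.of A M) :=
  gen_le_iff.1 le_rfl

lemma gen_le_leftPerp [Module.Finite A M] :
    gen k A M ≤ leftPerp k A N ↔ ∀ f : M →ₗ[A] N, f = 0 :=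
  gen_le_iff.trans mem_leftPerp

lemma exists_ne_zero_of_mem_gen [Module.Finite A M] [Nontrivial N]
    (h : (gen k A M).carrier (ModuleCat.of A N)) : ∃ f : M →ₗ[A] N, f ≠ 0 := by
  by_contra! h0
  exact not_subsingleton N (subsingleton_of_le_leftPerp (gen_le_leftPerp.2 h0) h)

lemma le_leftPerp_of_isTorsionPair {T : Tors k A} {F : ObjectProperty (ModuleCat.{u} A)}
    (hF : IsTorsionPair T.carrier F) (h : F (ModuleCat.of A M)) : T ≤ leftPerp k A M :=
  fun X hX => ⟨hF.finite_left X hX, fun f => hF.hom_eq_zero hX h f⟩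

/-- If all maps from T to M vanish, so does the inclusion of the torsion submodule of M. This
removes F from the discussion and turns torsion-freeness into an inequality between torsion classes.
-/
lemma torsionFree_iff {T : Tors k A} {F : ObjectProperty (ModuleCat.{u} A)}
    (hF : IsTorsionPair T.carrier F) [Module.Finite A M] :
    F (ModuleCat.of A M) ↔ T ≤ leftPerp k A M := by
  refine ⟨le_leftPerp_of_isTorsionPair hF, fun h => ?_⟩
  obtain ⟨t, ⟨ht, htF⟩, -⟩ := hF.existsUnique_torsion (ModuleCat.of A M) ‹_›
  change Submodule A M at t
  have h0 : t = ⊥ := by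
    have := eq_zero_of_le_leftPerp h ht t.subtype
    rw [← Submodule.range_subtype t, this, LinearMap.range_zero]
  subst h0
  exact IsTorsionPair.of_injective hF.subobjects (Submodule.mkQ ⊥)
    (LinearMap.ker_eq_bot.1 (Submodule.ker_mkQ _)) htF

lemma exists_torsion (T : Tors k A) (M : Type u) [AddCommGroup M] [Module A M]
    [Module.Finite A M] : ∃ t : Submodule A M,
      T.carrier (ModuleCat.of A t) ∧ T ≤ leftPerp k A (M ⧸ t) := by
  obtain ⟨F, hF⟩ := T.exists_pair
  obtain ⟨t, ⟨ht, htF⟩, -⟩ := hF.existsUnique_torsion (ModuleCat.of A M) ‹_›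
  exact ⟨t, ht, le_leftPerp_of_isTorsionPair hF htF⟩

lemma extension (T : Tors k A) [Module.Finite A M] (N : Submodule A M)
    (h1 : T.carrier (ModuleCat.of A N)) (h2 : T.carrier (ModuleCat.of A (M ⧸ N))) :
    T.carrier (ModuleCat.of A M) := by
  obtain ⟨F, hF⟩ := T.exists_pair
  exact hF.extension N h1 h2

end Basic

lemma isBrickSplitting_iff (T : Tors k A) : T.IsBrickSplitting ↔
    ∀ X : ModuleCat.{u} A, IsBrick X → gen k A X ≤ T ∨ T ≤ leftPerp k A X := by
  constructor
  · rintro ⟨F, hF, h⟩ X hX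
    have := hX.1
    exact (h X hX).imp gen_le_iff.2 (torsionFree_iff hF).1
  · intro h
    obtain ⟨F, hF⟩ := T.exists_pair
    refine ⟨F, hF, fun X hX => ?_⟩
    have := hX.1
    exact (h X hX).imp gen_le_iff.1 (torsionFree_iff hF).2

/-- If `T` is not contained in `U`, then a nonzero module of minimal length which is torsion
for `T` and torsion-free for `U` is a brick. -/
lemma exists_minimal_brick {T U : Tors k A} (h : ¬ T ≤ U) :
    ∃ X : ModuleCat.{u} A, IsBrick X ∧ gen k A X ≤ T ∧ U ≤ leftPerp k A X ∧
      ∀ N : Submodule A X, N ≠ ⊥ → T.carrier (ModuleCat.of A N) → N = ⊤ := by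
  have : IsArtinianRing A := IsArtinianRing.of_finite k A
  let S : Set (ModuleCat.{u} A) :=
    {M | Nontrivial M ∧ T.carrier M ∧ U ≤ leftPerp k A M}
  have hS : S.Nonempty := by
    by_contra hS
    apply h
    intro M hM
    have := T.module_finite hM
    obtain ⟨t, ht, htF⟩ := U.exists_torsion M
    have h1 : T.carrier (ModuleCat.of A (M ⧸ t)) := T.of_surjective t.mkQ t.mkQ_surjective hM
    have h2 : Subsingleton (M ⧸ t) := by
      by_contra h3
      exact hS ⟨ModuleCat.of A (M ⧸ t), not_subsingleton_iff_nontrivial.1 h3, h1, htF⟩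
    have h5 : t = ⊤ := Submodule.Quotient.subsingleton_iff.1 h2
    exact U.of_surjective t.subtype (fun x => ⟨⟨x, h5 ▸ Submodule.mem_top⟩, rfl⟩) ht
  obtain ⟨X, ⟨hX0, hXT, hXU⟩, hmin⟩ :=
    -- Submodules of a U-torsion-free module are U-torsion-free, so minimal length leaves no proper
    -- nonzero T-torsion submodule.
    WellFounded.has_min (InvImage.wf (fun M : ModuleCat.{u} A => Module.length A M) wellFounded_lt)
      S hS
  have hfin : Module.Finite A X := T.module_finite hXT
  have key : ∀ N : Submodule A X, N ≠ ⊥ → T.carrier (ModuleCat.of A N) → N = ⊤ := by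
    intro N hN hNT
    by_contra hne
    refine hmin (ModuleCat.of A N) ⟨(Submodule.nontrivial_iff_ne_bot).2 hN, hNT, ?_⟩
      (Submodule.length_lt hne)
    exact hXU.trans (leftPerp_le_of_injective N.subtype Subtype.val_injective)
  refine ⟨X, ⟨hfin, ?_, fun f hf => ?_⟩, gen_le_iff.2 hXT, hXU, key⟩
  · obtain ⟨x, hx⟩ := exists_ne (0 : X)
    exact ⟨1, 0, fun h => hx (LinearMap.congr_fun h x)⟩
  · have hsurj : Function.Surjective f := LinearMap.range_eq_top.1 <|
      key (LinearMap.range f) (fun h => hf (LinearMap.range_eq_bot.1 h)) (T.range_mem f hXT)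
    exact (Module.End.isUnit_iff f).2
      ⟨IsNoetherian.injective_of_surjective_endomorphism f hsurj, hsurj⟩

/-! ### Torsion classes attached to bricks. -/

section Brick

variable {B C : ModuleCat.{u} A}

lemma not_gen_le_leftPerp_self (hB : IsBrick B) : ¬ gen k A B ≤ leftPerp k A B := by
  have := hB.1
  exact fun h => hB.id_ne_zero (gen_le_leftPerp.1 h _)

/-- The image of f is a nonzero quotient of M, so it lies in `gen k A B` and receives a nonzero map
from B. Composed with the inclusion, this is a nonzero endomorphism of the brick B, hence onto. -/
lemma surjective_of_mem_gen (hB : IsBrick B) {M : Type u} [AddCommGroup M] [Module A M]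
    (hM : (gen k A B).carrier (ModuleCat.of A M)) {f : M →ₗ[A] B} (hf : f ≠ 0) :
    Function.Surjective f := by
  have := hB.1
  have : Nontrivial (LinearMap.range f) :=
    Submodule.nontrivial_iff_ne_bot.2 fun h => hf (LinearMap.range_eq_bot.1 h)
  obtain ⟨g, hg⟩ := exists_ne_zero_of_mem_gen ((gen k A B).range_mem f hM)
  have h0 : (LinearMap.range f).subtype ∘ₗ g ≠ 0 := fun h =>
    hg (LinearMap.ext fun x => Subtype.ext (LinearMap.congr_fun h x))
  intro b
  obtain ⟨x, rfl⟩ := (hB.bijective h0).2 b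
  exact (g x).2

/-- Dual argument: the image of f embeds in M, so it is not in `leftPerp k A B` and has a nonzero
map to B. The composite endomorphism of B is nonzero, hence injective. -/
lemma injective_of_leftPerp_le (hB : IsBrick B) {M : Type u} [AddCommGroup M] [Module A M]
    (hM : leftPerp k A B ≤ leftPerp k A M) {f : B →ₗ[A] M} (hf : f ≠ 0) :
    Function.Injective f := by
  have := hB.1
  have : Module.Finite A (LinearMap.range f) := Module.Finite.range f
  have hnt : Nontrivial (LinearMap.range f) :=
    Submodule.nontrivial_iff_ne_bot.2 fun h => hf (LinearMap.range_eq_bot.1 h)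
  obtain ⟨g, hg⟩ : ∃ g : LinearMap.range f →ₗ[A] B, g ≠ 0 := by
    by_contra! h0
    refine not_subsingleton (LinearMap.range f) (subsingleton_of_le_leftPerp (k := k) (hM.trans
      (leftPerp_le_of_injective (LinearMap.range f).subtype Subtype.val_injective)) ?_)
    exact mem_leftPerp.2 h0
  have h0 : g ∘ₗ f.rangeRestrict ≠ 0 := by
    intro h
    refine hg (LinearMap.ext fun y => ?_)
    obtain ⟨x, rfl⟩ := f.surjective_rangeRestrict y
    exact LinearMap.congr_fun h x
  intro x y hxy
  refine (hB.bijective h0).1 ?_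
  have : f.rangeRestrict x = f.rangeRestrict y := Subtype.ext hxy
  simp [this]

/-- A nonzero map from a module of T to B would be onto and put B in T. This makes `gen k A B`
join-irreducible. -/
lemma le_leftPerp_of_lt_gen (hB : IsBrick B) {T : Tors k A} (h : T < gen k A B) :
    T ≤ leftPerp k A B := by
  have := hB.1
  intro M hM
  refine ⟨T.module_finite hM, fun f => ?_⟩
  by_contra hf
  exact h.not_ge (gen_le_iff.2 (T.of_surjective f (surjective_of_mem_gen hB (h.le M hM) hf) hM))

/-- The projection of B onto its T-torsion-free quotient is zero or injective; injectivity would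
make B torsion-free for T. This makes `leftPerp k A B` meet-irreducible. -/
lemma gen_le_of_leftPerp_lt (hB : IsBrick B) {T : Tors k A} (h : leftPerp k A B < T) :
    gen k A B ≤ T := by
  have := hB.1
  obtain ⟨t, ht, htF⟩ := T.exists_torsion B
  have h0 : t.mkQ = 0 := by
    by_contra h0
    exact h.not_ge (htF.trans
      (leftPerp_le_of_injective t.mkQ (injective_of_leftPerp_le hB (h.le.trans htF) h0)))
  have h5 : t = ⊤ := by rw [← Submodule.ker_mkQ t, h0, LinearMap.ker_zero]
  exact gen_le_iff.2 (T.of_surjective t.subtype (fun x => ⟨⟨x, h5 ▸ Submodule.mem_top⟩, rfl⟩) ht)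

lemma nonempty_iso_of_gen_eq (hB : IsBrick B) (hC : IsBrick C) (h : gen k A B = gen k A C) :
    Nonempty (B ≅ C) := by
  have := hB.1
  have := hC.1
  have hBC : ∃ f : B →ₗ[A] C, f ≠ 0 := by
    by_contra! h0
    exact not_gen_le_leftPerp_self hC (h ▸ gen_le_leftPerp.2 h0)
  have hCB : ∃ f : C →ₗ[A] B, f ≠ 0 := by
    by_contra! h0
    exact not_gen_le_leftPerp_self hB (h ▸ gen_le_leftPerp.2 h0)
  obtain ⟨f, hf⟩ := hBC
  obtain ⟨g, hg⟩ := hCB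
  have hf' : Function.Surjective f := surjective_of_mem_gen hC (h ▸ mem_gen) hf
  have h0 : g ∘ₗ f ≠ 0 := fun h0 => hg (LinearMap.ext fun y => by
    obtain ⟨x, rfl⟩ := hf' y
    exact LinearMap.congr_fun h0 x)
  exact nonempty_iso_of_bijective f ⟨Function.Injective.of_comp (hB.bijective h0).1, hf'⟩

lemma nonempty_iso_of_leftPerp_eq (hB : IsBrick B) (hC : IsBrick C)
    (h : leftPerp k A B = leftPerp k A C) : Nonempty (B ≅ C) := by
  have := hB.1
  have := hC.1
  have hBC : ∃ f : B →ₗ[A] C, f ≠ 0 := by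
    by_contra! h0
    exact not_gen_le_leftPerp_self hB (h ▸ gen_le_leftPerp.2 h0)
  have hCB : ∃ f : C →ₗ[A] B, f ≠ 0 := by
    by_contra! h0
    exact not_gen_le_leftPerp_self hC (h ▸ gen_le_leftPerp.2 h0)
  obtain ⟨f, hf⟩ := hBC
  obtain ⟨g, hg⟩ := hCB
  have hf' : Function.Injective f := injective_of_leftPerp_le hB h.le hf
  have h0 : f ∘ₗ g ≠ 0 := fun h0 => hg (LinearMap.ext fun y => hf' (by
    simpa using LinearMap.congr_fun h0 y))
  exact nonempty_iso_of_bijective f ⟨hf', Function.Surjective.of_comp (hC.bijective h0).2⟩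

/-- Otherwise B has a proper nonzero torsion submodule t. Left modularity for `gen k A (B ⧸ t) ≤ gen
k A B` writes `gen k A B` as the join of `gen k A (B ⧸ t)` and `T ⊓ gen k A B`. Neither part maps
nontrivially to B, so B would lie in its own left perpendicular class. -/
lemma gen_le_or_le_leftPerp_of_isLeftModularElement (hB : IsBrick B) {T : Tors k A}
    (hT : IsLeftModularElement T) : gen k A B ≤ T ∨ T ≤ leftPerp k A B := by
  have := hB.1
  by_contra! h
  obtain ⟨t, ht, htF⟩ := T.exists_torsion B
  have htne : t ≠ ⊥ := by
    rintro rfl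
    exact h.2 (htF.trans (leftPerp_le_of_injective (Submodule.mkQ ⊥)
      (LinearMap.ker_eq_bot.1 (Submodule.ker_mkQ _))))
  have hle : gen k A (B ⧸ t) ≤ gen k A B :=
    gen_le_iff.2 ((gen k A B).of_surjective t.mkQ t.mkQ_surjective mem_gen)
  have hmem : gen k A B ≤ gen k A (B ⧸ t) ⊔ T := gen_le_iff.2 <|
    Tors.extension _ t ((le_sup_right : T ≤ gen k A (B ⧸ t) ⊔ T) _ ht)
      (gen_le_iff.1 (le_sup_left : gen k A (B ⧸ t) ≤ gen k A (B ⧸ t) ⊔ T))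
  have hmod := hT _ _ hle
  rw [inf_eq_right.2 hmem] at hmod
  refine not_gen_le_leftPerp_self (k := k) hB (hmod.le.trans (sup_le ?_ ?_))
  · refine gen_le_leftPerp.2 fun g => ?_
    by_contra hg
    have h0 : g ∘ₗ t.mkQ ≠ 0 := fun h0 => hg (LinearMap.ext fun y => by
      obtain ⟨x, rfl⟩ := t.mkQ_surjective y
      exact LinearMap.congr_fun h0 x)
    have hinj : Function.Injective t.mkQ := Function.Injective.of_comp (hB.bijective h0).1
    exact htne (by rw [← Submodule.ker_mkQ t, LinearMap.ker_eq_bot.2 hinj])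
  · exact le_leftPerp_of_lt_gen hB (lt_of_le_of_ne inf_le_right fun h' =>
      h.1 (inf_eq_right.1 h'))

/-- The bricks labelling a cover relation in the lattice of torsion classes are isomorphic. -/
lemma nonempty_iso_of_cover (hB : IsBrick B) (hC : IsBrick C) {U : Tors k A}
    (hUB : U ≤ leftPerp k A B) (hUC : U ≤ leftPerp k A C) (hCB : gen k A C ≤ U ⊔ gen k A B)
    (h : ∀ X : ModuleCat.{u} A, IsBrick X → gen k A X ≤ U ⊔ gen k A B → U ≤ leftPerp k A X →
      gen k A B ≤ U ⊔ gen k A X) : Nonempty (B ≅ C) := by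
  have hnle : ¬ U ⊔ gen k A B ≤ U := fun hle =>
    not_gen_le_leftPerp_self hB ((le_sup_right.trans hle).trans hUB)
  obtain ⟨X, hX, hXV, hXU, hmin⟩ := exists_minimal_brick hnle
  have key : ∀ Z : ModuleCat.{u} A, IsBrick Z → gen k A Z ≤ U ⊔ gen k A B → U ≤ leftPerp k A Z →
      Nonempty (Z ≅ X) := by
    intro Z hZ hZV hZU
    have := hX.1
    have := hZ.1
    -- By `h`, such a P generates all of `U ⊔ gen k A B` over U. If P had no nonzero map to Q, then
    -- Q would be left orthogonal to itself.
    have hom : ∀ {P Q : ModuleCat.{u} A}, IsBrick P → IsBrick Q → gen k A P ≤ U ⊔ gen k A B →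
        U ≤ leftPerp k A P → gen k A Q ≤ U ⊔ gen k A B → U ≤ leftPerp k A Q →
        ∃ f : P →ₗ[A] Q, f ≠ 0 := by
      intro P Q hP hQ hPV hPU hQV hQU
      have := hP.1
      by_contra! h0
      have h1 : U ⊔ gen k A P ≤ leftPerp k A Q := sup_le hQU (gen_le_leftPerp.2 h0)
      exact not_gen_le_leftPerp_self hQ
        (hQV.trans ((sup_le le_sup_left (h P hP hPV hPU)).trans h1))
    obtain ⟨g, hg⟩ := hom hZ hX hZV hZU hXV hXU
    obtain ⟨f, hf⟩ := hom hX hZ hXV hXU hZV hZU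
    have hg' : Function.Surjective g := LinearMap.range_eq_top.1 <|
      hmin _ (fun h => hg (LinearMap.range_eq_bot.1 h)) (range_mem _ g (gen_le_iff.1 hZV))
    have h0 : f ∘ₗ g ≠ 0 := fun h0 => hf (LinearMap.ext fun y => by
      obtain ⟨x, rfl⟩ := hg' y
      exact LinearMap.congr_fun h0 x)
    exact nonempty_iso_of_bijective g ⟨Function.Injective.of_comp (hZ.bijective h0).1, hg'⟩
  obtain ⟨e⟩ := key B hB le_sup_right hUB
  obtain ⟨e'⟩ := key C hC hCB hUC
  exact ⟨e ≪≫ e'.symm⟩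

end Brick

end Tors

/-! ### Finite lattices separated by pairs of elements -/

section SeparatedLattice

lemma Set.encard_le_of_injOn_nat {α : Type*} {C : Set α} {f : α → ℕ} {n : ℕ} (hf : Set.InjOn f C)
    (hn : ∀ x ∈ C, f x ≤ n) : C.encard ≤ n + 1 := by
  have := Set.encard_le_encard_of_injOn (t := (Finset.range (n + 1) : Set ℕ)) (f := f)
    (fun x hx => by simpa [Nat.lt_succ_iff] using hn x hx) hf
  rw [Set.encard_coe_eq_coe_finsetCard, Finset.card_range] at this
  exact_mod_cast this

/-- Ties of r are broken lexicographically by an enumeration of ι. -/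
lemma exists_injective_height {ι : Type*} [Finite ι] {R : ι → ι → Prop} {r : ι → ℕ}
    (hr : ∀ b c, R b c → r c < r b) :
    ∃ s : ι → ℕ, Function.Injective s ∧ ∀ b c, R b c → s c < s b := by
  obtain ⟨n, ⟨e⟩⟩ := Finite.exists_equiv_fin ι
  have hlt : ∀ b c, r c < r b → r c * n + (e c : ℕ) < r b * n + e b := by
    intro b c hbc
    have h1 : (r c + 1) * n ≤ r b * n := Nat.mul_le_mul_right n hbc
    have h2 := (e c).2
    rw [Nat.add_mul, one_mul] at h1
    omega
  refine ⟨fun b => r b * n + e b, fun b c hbc => ?_, fun b c hbc => hlt b c (hr b c hbc)⟩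
  rcases lt_trichotomy (r b) (r c) with h | h | h
  · exact absurd hbc (hlt c b h).ne
  · simp only [h, add_right_inj] at hbc
    exact e.injective (Fin.ext hbc)
  · exact absurd hbc (hlt b c h).ne'

variable {L ι : Type*} [CompleteLattice L] {j m : ι → L}

/-- Every failing inequality in `L` is detected by one of the pairs `(j b, m b)`, and `j b ≤ m b`
never holds.  This is the data of join-irreducible elements with their associated
meet-irreducible elements in a semidistributive lattice. -/
structure IsSeparating (j m : ι → L) : Prop where
  not_le (b : ι) : ¬ j b ≤ m b
  exists_of_not_le {x y : L} : ¬ x ≤ y → ∃ b, j b ≤ x ∧ y ≤ m b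

/-- An element `x` is splitting if each pair `(j b, m b)` has `j b` below or `m b` above `x`. -/
def IsSplitting (j m : ι → L) (x : L) : Prop := ∀ b, j b ≤ x ∨ x ≤ m b

lemma IsSplitting.sup {x y : L} (hx : IsSplitting j m x) (hy : IsSplitting j m y) :
    IsSplitting j m (x ⊔ y) := fun b => by
  rcases hx b with hb | hb
  · exact .inl (hb.trans le_sup_left)
  · exact (hy b).imp (fun hb' => hb'.trans le_sup_right) (fun hb' => sup_le hb hb')

lemma IsSplitting.inf {x y : L} (hx : IsSplitting j m x) (hy : IsSplitting j m y) :
    IsSplitting j m (x ⊓ y) := fun b => by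
  rcases hx b with hb | hb
  · exact (hy b).imp (fun hb' => le_inf hb hb') (fun hb' => inf_le_right.trans hb')
  · exact .inr (inf_le_left.trans hb)

lemma isSplitting_bot : IsSplitting j m (⊥ : L) := fun _ => .inr bot_le

/-- A chain of splitting elements which separates `ι` yields a strict height function for the
relation `¬ j b ≤ m c`. -/
lemma exists_height_of_separating {C : Set L} [Finite L] (hsplit : ∀ x ∈ C, IsSplitting j m x)
    (hsep : ∀ b c, b ≠ c → ∃ x ∈ C, ¬ (j b ≤ x ↔ j c ≤ x)) :
    ∃ r : ι → ℕ, ∀ b c, b ≠ c → ¬ j b ≤ m c → r c < r b := by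
  -- A splitting x above `j b` cannot lie below `m c`, so it is above `j c`; separation makes the
  -- inclusion of counted sets strict.
  refine ⟨fun b => {x ∈ C | ¬ j b ≤ x}.ncard, fun b c hbc hjm => ?_⟩
  have hle : ∀ x ∈ C, j b ≤ x → j c ≤ x := fun x hx hb =>
    (hsplit x hx c).resolve_right fun hc => hjm (hb.trans hc)
  refine Set.ncard_lt_ncard ⟨fun x hx => ⟨hx.1, fun hb => hx.2 (hle x hx.1 hb)⟩, fun hsub => ?_⟩
  obtain ⟨x, hx, hne⟩ := hsep b c hbc
  refine hne ⟨hle x hx, fun hc => ?_⟩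
  by_contra hb
  exact (hsub ⟨hx, hb⟩).2 hc

/-! ### Splitting elements, chain lengths and irreducibles. -/

namespace IsSeparating

lemma le_of_forall (h : IsSeparating j m) {x y : L} (hxy : ∀ b, j b ≤ x → j b ≤ y) : x ≤ y := by
  by_contra hne
  obtain ⟨b, hb, hb'⟩ := h.exists_of_not_le hne
  exact h.not_le b ((hxy b hb).trans hb')

lemma le_of_forall' (h : IsSeparating j m) {x y : L} (hxy : ∀ b, y ≤ m b → x ≤ m b) : x ≤ y := by
  by_contra hne
  obtain ⟨b, hb, hb'⟩ := h.exists_of_not_le hne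
  exact h.not_le b (hb.trans (hxy b hb'))

lemma injective_lower (h : IsSeparating j m) : Function.Injective fun x : L =>
    {b | j b ≤ x} := fun _ _ hxy =>
  le_antisymm (h.le_of_forall fun _ hb => hxy.subset hb)
    (h.le_of_forall fun _ hb => hxy.superset hb)

lemma lower_ssubset (h : IsSeparating j m) {x y : L} (hxy : x < y) : {b | j b ≤ x} ⊂
    {b | j b ≤ y} :=
  ⟨fun _ hb => le_trans hb hxy.le, fun hle => hxy.not_ge (h.le_of_forall fun _ hb => hle hb)⟩

lemma upper_ssubset (h : IsSeparating j m) {x y : L} (hxy : x < y) : {b | y ≤ m b} ⊂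
    {b | x ≤ m b} :=
  ⟨fun _ hb => hxy.le.trans hb, fun hle => hxy.not_ge (h.le_of_forall' fun _ hb => hle hb)⟩

lemma finite (h : IsSeparating j m) [Finite ι] : Finite L := Finite.of_injective _ h.injective_lower

/-- A pair detecting a failure of the modular law would have `j b ≤ m b`, whichever way x splits it.
-/
lemma isLeftModularElement (h : IsSeparating j m) {x : L}
    (hx : IsSplitting j m x) : IsLeftModularElement x := by
  intro y z hyz
  refine le_antisymm ?_ (sup_le (le_inf le_sup_left hyz) (inf_le_inf_right z le_sup_right))
  by_contra hne
  obtain ⟨b, hb, hb'⟩ := h.exists_of_not_le hne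
  obtain ⟨h1, h2⟩ := le_inf_iff.1 hb
  obtain ⟨h3, h4⟩ := sup_le_iff.1 hb'
  rcases hx b with hx | hx
  · exact h.not_le b ((le_inf hx h2).trans h4)
  · exact h.not_le b (h1.trans (sup_le h3 hx))

lemma inf_sup_left_of_isSplitting (h : IsSeparating j m) {x y z : L} (hy : IsSplitting j m y)
    (hz : IsSplitting j m z) : x ⊓ (y ⊔ z) = (x ⊓ y) ⊔ (x ⊓ z) := by
  refine le_antisymm ?_ le_inf_sup
  refine h.le_of_forall fun b hb => ?_
  obtain ⟨h1, h2⟩ := le_inf_iff.1 hb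
  rcases hy b with hy | hy
  · exact (le_inf h1 hy).trans le_sup_left
  rcases hz b with hz | hz
  · exact (le_inf h1 hz).trans le_sup_right
  · exact absurd (h2.trans (sup_le hy hz)) (h.not_le b)

lemma isDistributiveSublattice (h : IsSeparating j m) : IsDistributiveSublattice
    {x | IsSplitting j m x} :=
  ⟨⟨fun _ hx _ hy => hx.sup hy, fun _ hx _ hy => hx.inf hy⟩,
    fun _ _ _ hy _ hz => h.inf_sup_left_of_isSplitting hy hz⟩

lemma injOn_ncard_lower (h : IsSeparating j m) [Finite ι] {C : Set L} (hC : IsChain (· ≤ ·) C) :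
    Set.InjOn (fun x => {b | j b ≤ x}.ncard) C := by
  intro x hx y hy hxy
  by_contra hne
  rcases hC.total hx hy with hle | hle
  · exact (Set.ncard_lt_ncard (h.lower_ssubset (lt_of_le_of_ne hle hne))).ne hxy
  · exact (Set.ncard_lt_ncard (h.lower_ssubset (lt_of_le_of_ne hle (Ne.symm hne)))).ne' hxy

lemma injOn_ncard_upper (h : IsSeparating j m) [Finite ι] {C : Set L} (hC : IsChain (· ≤ ·) C) :
    Set.InjOn (fun x => {b | x ≤ m b}.ncard) C := by
  intro x hx y hy hxy
  by_contra hne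
  rcases hC.total hx hy with hle | hle
  · exact (Set.ncard_lt_ncard (h.upper_ssubset (lt_of_le_of_ne hle hne))).ne' hxy
  · exact (Set.ncard_lt_ncard (h.upper_ssubset (lt_of_le_of_ne hle (Ne.symm hne)))).ne hxy

lemma encard_chain_le (h : IsSeparating j m) [Finite ι] {C : Set L} (hC : IsChain (· ≤ ·) C) :
    C.encard ≤ Nat.card ι + 1 :=
  Set.encard_le_of_injOn_nat (h.injOn_ncard_lower hC) fun _ _ => Set.ncard_le_card _

/-- The parts of C below and above x share only x, and their sizes are bounded by the numbers of b
with `j b ≤ x` and with `x ≤ m b`, plus one each. These two sets of indices are disjoint, so a chain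
this long forces them to cover ι. -/
lemma isSplitting_of_mem_chain (h : IsSeparating j m) [Finite ι] {C : Set L} (hC : IsChain
    (· ≤ ·) C)
    (hcard : Nat.card ι + 1 ≤ C.encard) {x : L} (hx : x ∈ C) : IsSplitting j m x := by
  have h1 : {y ∈ C | y ≤ x}.encard ≤ {b | j b ≤ x}.ncard + 1 :=
    Set.encard_le_of_injOn_nat (h.injOn_ncard_lower (hC.mono fun _ hy => hy.1)) fun y hy =>
      Set.ncard_le_ncard fun b hb => le_trans hb hy.2
  have h2 : {y ∈ C | x ≤ y}.encard ≤ {b | x ≤ m b}.ncard + 1 :=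
    Set.encard_le_of_injOn_nat (h.injOn_ncard_upper (hC.mono fun _ hy => hy.1)) fun y hy =>
      Set.ncard_le_ncard fun b hb => le_trans hy.2 hb
  have h3 : C = {y ∈ C | y ≤ x} ∪ {y ∈ C | x ≤ y} := by
    ext y
    have := fun hy : y ∈ C => hC.total hy hx
    simp only [Set.mem_union, Set.mem_ofPred_eq]
    tauto
  have h4 : {y ∈ C | y ≤ x} ∩ {y ∈ C | x ≤ y} = {x} := by
    ext y
    simp only [Set.mem_inter_iff, Set.mem_ofPred_eq, Set.mem_singleton_iff]
    constructor
    · rintro ⟨⟨_, h⟩, _, h'⟩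
      exact le_antisymm h h'
    · rintro rfl
      exact ⟨⟨hx, le_rfl⟩, hx, le_rfl⟩
  have h5 := Set.encard_union_add_encard_inter {y ∈ C | y ≤ x} {y ∈ C | x ≤ y}
  rw [← h3, h4, Set.encard_singleton] at h5
  have hdisj : Disjoint {b | j b ≤ x} {b | x ≤ m b} :=
    Set.disjoint_left.2 fun b hb hb' => h.not_le b (le_trans hb hb')
  have h6 := Set.ncard_union_eq hdisj
  have h7 : Nat.card ι ≤ ({b | j b ≤ x} ∪ {b | x ≤ m b}).ncard := by
    have : (Nat.card ι : ℕ∞) + 1 + 1 ≤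
        ({b | j b ≤ x}.ncard + 1 : ℕ∞) + ({b | x ≤ m b}.ncard + 1 : ℕ∞) :=
      (add_le_add_left hcard 1).trans (h5.le.trans (add_le_add h1 h2))
    have : Nat.card ι + 1 + 1 ≤ ({b | j b ≤ x}.ncard + 1) + ({b | x ≤ m b}.ncard + 1) := by
      exact_mod_cast this
    omega
  have h8 := (Set.eq_univ_iff_ncard _).2 (le_antisymm (Set.ncard_le_card _) h7)
  exact fun b => h8.superset (Set.mem_univ b)

/-- If C did not separate b from c, deleting b from all sets `{d | j d ≤ x}` would keep them
distinct along C, and subsets of ι without b allow only chains of at most `Nat.card ι` members. -/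
lemma exists_separating_of_chain (h : IsSeparating j m) [Finite ι] {C : Set L} (hC : IsChain
    (· ≤ ·) C)
    (hcard : Nat.card ι + 1 ≤ C.encard) {b c : ι} (hbc : b ≠ c) :
    ∃ x ∈ C, ¬ (j b ≤ x ↔ j c ≤ x) := by
  by_contra! hsep
  have hlt : ∀ x ∈ C, ∀ y ∈ C, x < y → {d | j d ≤ x} \ {b} ⊂ {d | j d ≤ y} \ {b} := by
    intro x hx y hy hxy
    refine ⟨Set.sdiff_subset_sdiff_left (h.lower_ssubset hxy).1, fun hle => hxy.not_ge ?_⟩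
    refine h.le_of_forall fun d hd => ?_
    by_cases hdb : d = b
    · subst hdb
      exact (hsep x hx).2 (hle ⟨(hsep y hy).1 hd, fun h => hbc h.symm⟩).1
    · exact (hle ⟨hd, hdb⟩).1
  have hinj : Set.InjOn (fun x => ({d | j d ≤ x} \ {b}).ncard) C := by
    intro x hx y hy hxy
    by_contra hne
    rcases hC.total hx hy with hle | hle
    · exact (Set.ncard_lt_ncard (hlt x hx y hy (lt_of_le_of_ne hle hne))).ne hxy
    · exact (Set.ncard_lt_ncard (hlt y hy x hx (lt_of_le_of_ne hle (Ne.symm hne)))).ne' hxy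
  have hpos : 0 < Nat.card ι := Nat.card_pos_iff.2 ⟨⟨b⟩, inferInstance⟩
  have := Set.encard_le_of_injOn_nat (n := Nat.card ι - 1) hinj fun x _ => by
    have h1 : ({d | j d ≤ x} \ {b}).ncard < Nat.card ι := by
      rw [← Set.ncard_univ]
      exact Set.ncard_lt_ncard ⟨Set.subset_univ _, fun h => (h (Set.mem_univ b)).2 rfl⟩
    exact Nat.le_sub_one_of_lt h1
  have h2 : Nat.card ι + 1 ≤ Nat.card ι - 1 + 1 := by exact_mod_cast hcard.trans this
  omega

/-- If b and c were not separated, both would label the step of C from the last member x not above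
`j b` to `x ⊔ j b`. The hypothesis `hcov` says that such a step has only one label. -/
lemma exists_separating_of_isMaxChain (h : IsSeparating j m) [Finite ι]
    (hcov : ∀ (x : L) (b c : ι), x ≤ m b → x ≤ m c → j c ≤ x ⊔ j b →
      (∀ d, j d ≤ x ⊔ j b → x ≤ m d → j b ≤ x ⊔ j d) → b = c)
    {C : Set L} (hC : IsMaxChain (· ≤ ·) C) (hsplit : ∀ x ∈ C, IsSplitting j m x)
    {b c : ι} (hbc : b ≠ c) : ∃ x ∈ C, ¬ (j b ≤ x ↔ j c ≤ x) := by
  by_contra! hsep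
  have := h.finite
  obtain ⟨x, ⟨hxC, hxb⟩, hmax⟩ : ∃ x, Maximal (fun x => x ∈ C ∧ ¬ j b ≤ x) x :=
    (Set.toFinite {x | x ∈ C ∧ ¬ j b ≤ x}).exists_maximal
      ⟨⊥, hC.bot_mem, fun hb => h.not_le b (hb.trans bot_le)⟩
  -- Members of C above `j b` are above `x ⊔ j d`, the others are at most x; maximality of C does
  -- the rest.
  have hmem : ∀ d, (∀ y ∈ C, (j b ≤ y ↔ j d ≤ y)) → x ⊔ j d ∈ C := by
    intro d hd
    have hchain : IsChain (· ≤ ·) (insert (x ⊔ j d) C) := by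
      refine hC.isChain.insert fun y hy _ => ?_
      by_cases hb : j b ≤ y
      · refine .inl (sup_le ?_ ((hd y hy).1 hb))
        exact (hC.isChain.total hxC hy).resolve_right fun hyx => hxb (hb.trans hyx)
      · refine .inr (le_sup_of_le_left ?_)
        rcases hC.isChain.total hxC hy with hle | hle
        · exact hmax ⟨hy, hb⟩ hle
        · exact hle
    rw [hC.2 hchain (Set.subset_insert _ _)]
    exact Set.mem_insert _ _
  have hB := hmem b fun _ _ => Iff.rfl
  refine hbc (hcov x b c ((hsplit x hxC b).resolve_left hxb)
    ((hsplit x hxC c).resolve_left fun hc => hxb ((hsep x hxC).2 hc))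
    ((hsep _ hB).1 le_sup_right) fun d hd hxd => ?_)
  have hd' : ∀ y ∈ C, (j b ≤ y ↔ j d ≤ y) := by
    intro y hy
    constructor
    · intro hb
      refine hd.trans (sup_le ?_ hb)
      exact (hC.isChain.total hxC hy).resolve_right fun hyx => hxb (hb.trans hyx)
    · intro hdy
      by_contra hb
      have hyx : y ≤ x := (hC.isChain.total hxC hy).elim (fun hle => hmax ⟨hy, hb⟩ hle) id
      exact h.not_le d ((hdy.trans hyx).trans hxd)
  exact (hd' _ (hmem d hd')).2 le_sup_right

/-- The chain of splitting elements attached to a linear extension of the relation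
`¬ j b ≤ m c`, passing through a given splitting element. -/
lemma exists_chain_of_height (h : IsSeparating j m) [Finite ι] {r : ι → ℕ}
    (hr : ∀ b c, b ≠ c → ¬ j b ≤ m c → r c < r b) {x : L} (hx : IsSplitting j m x) :
    ∃ C : Set L, IsChain (· ≤ ·) C ∧ (∀ y ∈ C, IsSplitting j m y) ∧ x ∈ C ∧
      Nat.card ι + 1 ≤ C.encard := by
  classical
  obtain ⟨N, hN⟩ : ∃ N, ∀ b, r b < N := by
    obtain ⟨N, hN⟩ := (Set.finite_range r).bddAbove
    exact ⟨N + 1, fun b => Nat.lt_succ_of_le (hN ⟨b, rfl⟩)⟩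
  -- Raising by N the indices with `j b` not below x places those below x first, so that x becomes
  -- the join of an initial segment. The relation is respected because x is splitting.
  have hr' : ∀ b c, b ≠ c ∧ ¬ j b ≤ m c →
      r c + (if j c ≤ x then 0 else N) < r b + (if j b ≤ x then 0 else N) := by
    rintro b c ⟨hbc, hjm⟩
    have h1 := hr b c hbc hjm
    have h2 := hN c
    by_cases hb : j b ≤ x
    · have hc : j c ≤ x := (hx c).resolve_right fun hc => hjm (hb.trans hc)
      simpa [hb, hc] using h1
    · by_cases hc : j c ≤ x <;> simp [hb, hc] <;> omega
  obtain ⟨s₀, hs₀, hs₁⟩ := exists_injective_height (R := fun b c => (b ≠ c ∧ ¬ j b ≤ m c) ∨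
    (j c ≤ x ∧ ¬ j b ≤ x)) (r := fun b => r b + (if j b ≤ x then 0 else N)) (by
      rintro b c (hbc | ⟨hc, hb⟩)
      · exact hr' b c hbc
      · have := hN c
        simp [hb, hc]
        omega)
  -- For S closed under the relation `¬ j b ≤ m c`, the join over S lies above no further `j c`, and
  -- it is splitting.
  have hjoin : ∀ S : Set ι, (∀ b ∈ S, ∀ c ∉ S, j b ≤ m c) →
      ∀ c, (c ∈ S ↔ j c ≤ ⨆ b ∈ S, j b) ∧ (c ∉ S → ⨆ b ∈ S, j b ≤ m c) := by
    intro S hS c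
    have h1 : c ∉ S → ⨆ b ∈ S, j b ≤ m c := fun hc => iSup₂_le fun b hb => hS b hb c hc
    exact ⟨⟨fun hc => le_iSup₂_of_le c hc le_rfl, fun hc => by
      by_contra hc'
      exact h.not_le c (hc.trans (h1 hc'))⟩, h1⟩
  have hlow : ∀ n b, s₀ b < n → ∀ c, ¬ s₀ c < n → j b ≤ m c := by
    intro n b hb c hc
    by_contra hjm
    have hbc : b ≠ c := by
      rintro rfl
      exact hc hb
    have := hs₁ b c (.inl ⟨hbc, hjm⟩)
    omega
  let U : ℕ → L := fun n => ⨆ b ∈ {b | s₀ b < n}, j b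
  have hU : ∀ n c, (s₀ c < n ↔ j c ≤ U n) := fun n c =>
    (hjoin {b | s₀ b < n} (fun b hb c hc => hlow n b hb c hc) c).1
  have hUm : ∀ n c, ¬ s₀ c < n → U n ≤ m c := fun n c =>
    (hjoin {b | s₀ b < n} (fun b hb c hc => hlow n b hb c hc) c).2
  have hmono : Monotone U := fun n n' hn => h.le_of_forall fun b hb =>
    (hU n' b).1 (((hU n b).2 hb).trans_le hn)
  refine ⟨Set.range U, ?_, ?_, ?_, ?_⟩
  · rintro _ ⟨n, rfl⟩ _ ⟨n', rfl⟩ _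
    exact (le_total n n').imp (fun h => hmono h) (fun h => hmono h)
  · rintro _ ⟨n, rfl⟩ b
    by_cases hb : s₀ b < n
    · exact .inl ((hU n b).1 hb)
    · exact .inr (hUm n b hb)
  · obtain ⟨n, hn⟩ : ∃ n, ∀ b, s₀ b < n ↔ j b ≤ x := by
      by_cases hall : ∀ b, j b ≤ x
      · obtain ⟨n, hn⟩ := (Set.finite_range s₀).bddAbove
        exact ⟨n + 1, fun b => ⟨fun _ => hall b, fun _ => Nat.lt_succ_of_le (hn ⟨b, rfl⟩)⟩⟩
      · push Not at hall
        obtain ⟨b, hb, hmin⟩ := Set.exists_min_image {b | ¬ j b ≤ x} s₀ (Set.toFinite _) hall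
        refine ⟨s₀ b, fun c => ⟨fun hc => ?_, fun hc => hs₁ b c (.inr ⟨hc, hb⟩)⟩⟩
        by_contra hcx
        exact (hmin c hcx).not_gt hc
    exact ⟨n, le_antisymm (h.le_of_forall fun b hb => (hn b).1 ((hU n b).2 hb))
      (h.le_of_forall fun b hb => (hU n b).1 ((hn b).2 hb))⟩
  -- The values of `s₀` may have gaps, so U repeats; the members just after each index, together
  -- with `U 0`, are `Nat.card ι + 1` distinct ones.
  · let V : Option ι → L := fun o => o.elim (U 0) fun b => U (s₀ b + 1)
    have hV : Function.Injective V := by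
      have h0 : ∀ b, U 0 ≠ U (s₀ b + 1) := fun b hb => by
        have := (hU 0 b).2 (hb ▸ (hU (s₀ b + 1) b).1 (Nat.lt_succ_self _))
        omega
      rintro (_ | b) (_ | c) hbc
      · rfl
      · exact absurd hbc (h0 c)
      · exact absurd hbc.symm (h0 b)
      · have hbc' : U (s₀ b + 1) = U (s₀ c + 1) := hbc
        have h1 := (hU _ b).2 (hbc' ▸ (hU (s₀ b + 1) b).1 (Nat.lt_succ_self _))
        have h2 := (hU _ c).2 (hbc'.symm ▸ (hU (s₀ c + 1) c).1 (Nat.lt_succ_self _))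
        exact congrArg some (hs₀ (by omega))
    have hsub : Set.range V ⊆ Set.range U := by
      rintro _ ⟨_ | b, rfl⟩
      · exact ⟨0, rfl⟩
      · exact ⟨s₀ b + 1, rfl⟩
    refine le_trans (le_of_eq ?_) (Set.encard_le_encard hsub)
    rw [← Set.image_univ, hV.encard_image, Set.encard_univ, ENat.card_eq_coe_natCard,
      Finite.card_option]
    norm_cast

lemma isMaxChain_of_card_le (h : IsSeparating j m) [Finite ι] {C : Set L} (hC : IsChain (· ≤ ·) C)
    (hcard : Nat.card ι + 1 ≤ C.encard) : IsMaxChain (· ≤ ·) C := by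
  have := h.finite
  exact ⟨hC, fun D hD hCD => (Set.toFinite C).eq_of_subset_of_encard_le hCD
    ((h.encard_chain_le hD).trans hcard)⟩

lemma latticeSpine_eq (h : IsSeparating j m) [Finite ι] {r : ι → ℕ}
    (hr : ∀ b c, b ≠ c → ¬ j b ≤ m c → r c < r b) :
    latticeSpine L = {x | IsSplitting j m x} := by
  ext x
  constructor
  · rintro ⟨C, hC, hmax, hx⟩
    obtain ⟨D, hD, -, -, hDcard⟩ := h.exists_chain_of_height hr isSplitting_bot
    exact h.isSplitting_of_mem_chain hC (hDcard.trans (hmax D hD)) hx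
  · intro hx
    obtain ⟨C, hC, -, hxC, hcard⟩ := h.exists_chain_of_height hr hx
    exact ⟨C, hC, fun D hD => (h.encard_chain_le hD).trans hcard, hxC⟩

/-- Every x is the join of the `j b` below it, so a join-irreducible is some `j b`. Conversely,
elements strictly below `j b` have their join below `m b`. -/
lemma encard_supIrred (h : IsSeparating j m) [Finite ι] (hj : Function.Injective j)
    (hlt : ∀ b x, x < j b → x ≤ m b) : {x : L | SupIrred x}.encard = Nat.card ι := by
  have : {x : L | SupIrred x} = Set.range j := by
    ext x
    constructor
    · intro hx
      have := Fintype.ofFinite ι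
      classical
      obtain ⟨b, -, hb⟩ := hx.finset_sup_eq (s := Finset.univ.filter fun b => j b ≤ x) (f := j)
        (le_antisymm (Finset.sup_le fun b hb => (Finset.mem_filter.1 hb).2)
          (h.le_of_forall fun b hb => Finset.le_sup (f := j) (by simpa using hb)))
      exact ⟨b, hb⟩
    · rintro ⟨b, rfl⟩
      refine ⟨fun hmin => h.not_le b ((hmin bot_le).trans bot_le), fun {y z} hyz => ?_⟩
      by_contra! hne
      refine h.not_le b (hyz ▸ sup_le (hlt b y ?_) (hlt b z ?_))
      · exact lt_of_le_of_ne (hyz ▸ le_sup_left) hne.1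
      · exact lt_of_le_of_ne (hyz ▸ le_sup_right) hne.2
  rw [this, ← Set.image_univ, hj.encard_image, Set.encard_univ, ENat.card_eq_coe_natCard]

lemma encard_infIrred (h : IsSeparating j m) [Finite ι] (hm : Function.Injective m)
    (hlt : ∀ b x, m b < x → j b ≤ x) : {x : L | InfIrred x}.encard = Nat.card ι := by
  have : {x : L | InfIrred x} = Set.range m := by
    ext x
    constructor
    · intro hx
      have := Fintype.ofFinite ι
      classical
      obtain ⟨b, -, hb⟩ := hx.finset_inf_eq (s := Finset.univ.filter fun b => x ≤ m b) (f := m)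
        (le_antisymm
          (h.le_of_forall' fun b hb => Finset.inf_le (f := m) (by simpa using hb))
          (Finset.le_inf fun b hb => (Finset.mem_filter.1 hb).2))
      exact ⟨b, hb⟩
    · rintro ⟨b, rfl⟩
      refine ⟨fun hmax => h.not_le b (le_top.trans (hmax le_top)), fun {y z} hyz => ?_⟩
      by_contra! hne
      refine h.not_le b (hyz ▸ le_inf (hlt b y ?_) (hlt b z ?_))
      · exact lt_of_le_of_ne (hyz ▸ inf_le_left) hne.1.symm
      · exact lt_of_le_of_ne (hyz ▸ inf_le_right) hne.2.symm
  rw [this, ← Set.image_univ, hm.encard_image, Set.encard_univ, ENat.card_eq_coe_natCard]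

end IsSeparating

end SeparatedLattice

/-! ### Isomorphism classes of bricks and brick-cycles. -/

lemma exists_seq_of_transGen {α : Type*} {R : α → α → Prop} {b c : α}
    (h : Relation.TransGen R b c) : ∃ (n : ℕ) (Z : ℕ → α), Z 0 = b ∧ Z (n + 1) = c ∧
      ∀ i ≤ n, R (Z i) (Z (i + 1)) := by
  induction h with
  | @single c hbc =>
    refine ⟨0, fun i => if i = 0 then b else c, rfl, rfl, fun i hi => ?_⟩
    obtain rfl : i = 0 := by omega
    exact hbc
  | @tail c d _ hcd ih =>
    obtain ⟨n, Z, h0, h1, hZ⟩ := ih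
    refine ⟨n + 1, fun i => if i ≤ n + 1 then Z i else d, by simpa using h0, by simp, ?_⟩
    intro i hi
    rcases hi.lt_or_eq with hi | rfl
    · have h2 : i ≤ n + 1 := by omega
      have h3 : i + 1 ≤ n + 1 := by omega
      simp only [h2, h3, if_true]
      exact hZ i (by omega)
    · have h3 : ¬ n + 1 + 1 ≤ n + 1 := by omega
      simp only [le_refl, h3, if_true, if_false, h1]
      exact hcd

section BrickRepresentatives

open CategoryTheory Tors

variable {A : Type u} [Ring A]

/-- A representative of an isomorphism class of bricks. -/
noncomputable def brickRep (c : brickClasses A) : ModuleCat.{u} A := c.1.out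

lemma isBrick_brickRep (c : brickClasses A) : IsBrick (brickRep c) := by
  obtain ⟨X, hX, hc⟩ := c.2
  have h : Quotient.mk (isIsomorphicSetoid _) X = Quotient.mk _ (brickRep c) := by
    rw [hc]
    exact (Quotient.out_eq c.1).symm
  obtain ⟨e⟩ := Quotient.exact h
  exact hX.of_iso e

lemma eq_of_nonempty_iso {b c : brickClasses A} (h : Nonempty (brickRep b ≅ brickRep c)) :
    b = c :=
  Subtype.ext (by
    rw [← Quotient.out_eq b.1, ← Quotient.out_eq c.1]
    exact Quotient.sound h)

lemma exists_iso_brickRep {X : ModuleCat.{u} A} (hX : IsBrick X) :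
    ∃ c : brickClasses A, Nonempty (X ≅ brickRep c) :=
  ⟨⟨Quotient.mk _ X, X, hX, rfl⟩,
    Quotient.exact (s := isIsomorphicSetoid _) (Quotient.out_eq (Quotient.mk _ X)).symm⟩

lemma IsBrickDirected.not_transGen (h : IsBrickDirected A) (b : brickClasses A) :
    ¬ Relation.TransGen (fun b c : brickClasses A =>
      b ≠ c ∧ ∃ f : brickRep b →ₗ[A] brickRep c, f ≠ 0) b b := by
  intro hb
  obtain ⟨n, Z, h0, h1, hZ⟩ := exists_seq_of_transGen hb
  choose! hne f hf using hZ
  refine h ⟨n + 1, fun i => brickRep (Z i), fun i => ModuleCat.ofHom (f i), by omega,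
    fun i => isBrick_brickRep _, ⟨eqToIso (by simp [h0, h1])⟩,
    fun i => ⟨fun h0 => ?_, fun hi => ?_⟩⟩
  · exact hf i (Nat.le_of_lt_succ i.2) (congrArg ModuleCat.Hom.hom h0)
  · exact hne i (Nat.le_of_lt_succ i.2) (eq_of_nonempty_iso ⟨@asIso _ _ _ _ _ hi⟩)

/-- Brick-directedness in terms of a height function on the isomorphism classes of bricks. -/
lemma isBrickDirected_iff_exists_height [Finite (brickClasses A)] :
    IsBrickDirected A ↔ ∃ r : brickClasses A → ℕ, ∀ b c, b ≠ c →
      (∃ f : brickRep b →ₗ[A] brickRep c, f ≠ 0) → r c < r b := by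
  constructor
  · intro h
    let R : brickClasses A → brickClasses A → Prop := fun b c =>
      b ≠ c ∧ ∃ f : brickRep b →ₗ[A] brickRep c, f ≠ 0
    -- The height counts the classes reachable from b; c is reachable from b but, without cycles,
    -- not from itself.
    refine ⟨fun b => {c | Relation.TransGen R b c}.ncard, fun b c hbc hf => ?_⟩
    have hR : R b c := ⟨hbc, hf⟩
    exact Set.ncard_lt_ncard ⟨fun d hd => Relation.TransGen.head hR hd,
      fun hle => h.not_transGen c (hle (Relation.TransGen.single hR))⟩
  · rintro ⟨r, hr⟩ ⟨m, X, f, hm, hX, ⟨e⟩, hf⟩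
    choose c hc using fun i => exists_iso_brickRep (hX i)
    -- Nonzero maps between isomorphic bricks are invertible, so each map of the cycle changes the
    -- class and lowers the height.
    have hlt : ∀ i : Fin m, r (c i.succ) < r (c i.castSucc) := by
      intro i
      obtain ⟨e1⟩ := hc i.castSucc
      obtain ⟨e2⟩ := hc i.succ
      refine hr _ _ (fun heq => ?_) ⟨(e1.inv ≫ f i ≫ e2.hom).hom, fun h0 => ?_⟩
      · exact (hf i).2 ((hX _).isIso (e1 ≪≫ eqToIso (by rw [heq]) ≪≫ e2.symm) _ (hf i).1)
      · apply (hf i).1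
        have h1 : e1.inv ≫ f i ≫ e2.hom = 0 := ModuleCat.hom_ext h0
        simpa using congrArg (fun g => e1.hom ≫ g ≫ e2.inv) h1
    have hanti : StrictAnti fun i => r (c i) := Fin.strictAnti_iff_succ_lt.2 hlt
    have h0 : (0 : Fin (m + 1)) < Fin.last m := Fin.lt_def.2 (by
      simpa [Nat.pos_iff_ne_zero, Nat.one_le_iff_ne_zero] using hm)
    have hcc : c 0 = c (Fin.last m) := by
      obtain ⟨e1⟩ := hc 0
      obtain ⟨e2⟩ := hc (Fin.last m)
      exact eq_of_nonempty_iso ⟨e1.symm ≪≫ e ≪≫ e2⟩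
    exact (hanti h0).ne (by simp only [hcc])

variable (k : Type v) [Field k] [Algebra k A] [Module.Finite k A]

lemma gen_eq_of_iso {X Y : ModuleCat.{u} A} (hX : IsBrick X) (e : X ≅ Y) :
    gen k A X = gen k A Y := by
  have := hX.1
  have := (hX.of_iso e).1
  exact le_antisymm
    (gen_le_iff.2 (Tors.of_surjective _ e.symm.toLinearEquiv.toLinearMap
      e.symm.toLinearEquiv.surjective mem_gen))
    (gen_le_iff.2 (Tors.of_surjective _ e.toLinearEquiv.toLinearMap
      e.toLinearEquiv.surjective mem_gen))

lemma leftPerp_eq_of_iso {X Y : ModuleCat.{u} A} (e : X ≅ Y) :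
    leftPerp k A X = leftPerp k A Y :=
  le_antisymm
    (leftPerp_le_of_injective e.symm.toLinearEquiv.toLinearMap e.symm.toLinearEquiv.injective)
    (leftPerp_le_of_injective e.toLinearEquiv.toLinearMap e.toLinearEquiv.injective)

lemma isSeparating_brick : IsSeparating (fun b : brickClasses A => gen k A (brickRep b))
    (fun b => leftPerp k A (brickRep b)) where
  not_le b := not_gen_le_leftPerp_self (isBrick_brickRep b)
  exists_of_not_le h := by
    obtain ⟨X, hX, h1, h2, -⟩ := exists_minimal_brick h
    obtain ⟨c, ⟨e⟩⟩ := exists_iso_brickRep hX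
    exact ⟨c, gen_eq_of_iso k hX e ▸ h1, leftPerp_eq_of_iso k e ▸ h2⟩

lemma isBrickSplitting_iff_isSplitting (T : Tors k A) : T.IsBrickSplitting ↔
    IsSplitting (fun b : brickClasses A => gen k A (brickRep b))
      (fun b => leftPerp k A (brickRep b)) T := by
  rw [Tors.isBrickSplitting_iff]
  refine ⟨fun h b => h _ (isBrick_brickRep b), fun h X hX => ?_⟩
  obtain ⟨c, ⟨e⟩⟩ := exists_iso_brickRep hX
  rw [gen_eq_of_iso k hX e, leftPerp_eq_of_iso k e]
  exact h c

lemma not_gen_le_leftPerp_brickRep (b c : brickClasses A) :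
    (¬ gen k A (brickRep b) ≤ leftPerp k A (brickRep c)) ↔
      ∃ f : brickRep b →ₗ[A] brickRep c, f ≠ 0 := by
  have := (isBrick_brickRep b).1
  rw [gen_le_leftPerp, not_forall]

end BrickRepresentatives

/-! ### The theorem. -/

theorem theorem1p7 (k : Type v) (A : Type u) [Field k] [Ring A] [Algebra k A]
    [Module.Finite k A] (hA : IsBrickFinite A) :
    List.TFAE [
      IsBrickDirected A,
      IsLeftModularLattice (Tors k A),
      IsExtremalLattice (Tors k A),
      IsTrimLattice (Tors k A)] ∧
    (IsBrickDirected A →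
      latticeSpine (Tors k A) = {T : Tors k A | T.IsBrickSplitting} ∧
      IsDistributiveSublattice (latticeSpine (Tors k A))) := by
  have : Finite (brickClasses A) := hA
  have hsep := isSeparating_brick (A := A) k
  have hfin : Finite (Tors k A) := hsep.finite
  have hdir : IsBrickDirected A ↔ ∃ r : brickClasses A → ℕ, ∀ b c, b ≠ c →
      ¬ Tors.gen k A (brickRep b) ≤ Tors.leftPerp k A (brickRep c) → r c < r b := by
    simp only [not_gen_le_leftPerp_brickRep]
    exact isBrickDirected_iff_exists_height
  have hsup : {x : Tors k A | SupIrred x}.encard = Nat.card (brickClasses A) :=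
    hsep.encard_supIrred (fun b c h => eq_of_nonempty_iso
      (Tors.nonempty_iso_of_gen_eq (isBrick_brickRep b) (isBrick_brickRep c) h))
      fun b _ h => Tors.le_leftPerp_of_lt_gen (isBrick_brickRep b) h
  have hinf : {x : Tors k A | InfIrred x}.encard = Nat.card (brickClasses A) :=
    hsep.encard_infIrred (fun b c h => eq_of_nonempty_iso
      (Tors.nonempty_iso_of_leftPerp_eq (isBrick_brickRep b) (isBrick_brickRep c) h))
      fun b _ h => Tors.gen_le_of_leftPerp_lt (isBrick_brickRep b) h
  refine ⟨?_, fun h => ?_⟩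
  · tfae_have 1 → 4 := by
      intro h
      obtain ⟨r, hr⟩ := hdir.1 h
      obtain ⟨C, hC, hsplit, -, hcard⟩ := hsep.exists_chain_of_height hr isSplitting_bot
      have hmax := hsep.isMaxChain_of_card_le hC hcard
      have hcard' := le_antisymm (hsep.encard_chain_le hC) hcard
      exact ⟨⟨hfin, C, hmax, by rw [hsup, hcard'], by rw [hinf, hcard']⟩,
        hfin, C, hmax, fun x hx => hsep.isLeftModularElement (hsplit x hx)⟩
    tfae_have 4 → 2 := And.right
    tfae_have 4 → 3 := And.left
    tfae_have 3 → 1 := by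
      rintro ⟨-, C, hC, hcard, -⟩
      rw [hsup] at hcard
      exact hdir.2 (exists_height_of_separating
        (fun x hx => hsep.isSplitting_of_mem_chain hC.isChain hcard.ge hx)
        fun b c hbc => hsep.exists_separating_of_chain hC.isChain hcard.ge hbc)
    tfae_have 2 → 1 := by
      rintro ⟨-, C, hC, hmod⟩
      have hsplit : ∀ x ∈ C, IsSplitting (fun b : brickClasses A => Tors.gen k A (brickRep b))
          (fun b => Tors.leftPerp k A (brickRep b)) x := fun x hx b =>
        Tors.gen_le_or_le_leftPerp_of_isLeftModularElement (isBrick_brickRep b) (hmod x hx)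
      refine hdir.2 (exists_height_of_separating hsplit fun b c hbc =>
        hsep.exists_separating_of_isMaxChain (fun U b c hb hc hle hcov => ?_) hC hsplit hbc)
      -- The uniqueness of labels needed for a maximal chain is the uniqueness of the brick
      -- labelling a cover of torsion classes.
      refine eq_of_nonempty_iso (Tors.nonempty_iso_of_cover (isBrick_brickRep b)
        (isBrick_brickRep c) hb hc hle fun X hX h1 h2 => ?_)
      obtain ⟨d, ⟨e⟩⟩ := exists_iso_brickRep hX
      rw [gen_eq_of_iso k hX e] at h1 ⊢
      rw [leftPerp_eq_of_iso k e] at h2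
      exact hcov d h1 h2
    tfae_finish
  · obtain ⟨r, hr⟩ := hdir.1 h
    have hspine := hsep.latticeSpine_eq hr
    refine ⟨hspine.trans (Set.ext fun T => (isBrickSplitting_iff_isSplitting k T).symm), ?_⟩
    rw [hspine]
    exact hsep.isDistributiveSublattice
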